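/- Let $d\ge 2$, let $\mathcal{E}_+=\{e_1,\dots,e_d\}$ be the set of canonical basis vectors of $\mathbb{Z}^d$, and $\mathcal{E}=\mathcal{E}_+\cup(-\mathcal{E}_+)$. Let $E_1,\dots,E_k\subset\mathcal{E}_+$ be sets that all contain $e_1$, and let $r_1,\dots,r_k\ge 0$ with $\sum_{i=1}^k r_i=1$. Let $(U_x)_{x\in\mathbb{Z}^d}$, $(U'_x)_{x\in\mathbb{Z}^d}$ be i.i.d. random variables, uniform on $(0,1]$. For $p\in[0,1]$ set $$\mathcal{G}_x=\begin{cases}E_i,&\text{if } U_x<p \text{ and } U'_x\in\big[\sum_{j<i}r_j,\sum_{j\le i}r_j\big),\\ \mathcal{E},&\text{if } U_x\ge p \text{ and } U'_x\in[0,1)\end{cases}$$ (which defines $\mathcal{G}_x$ for all $x$ almost surely), and insert an arrow from each $x\in\mathbb{Z}^d$ to each $x+e$, $e\in\mathcal{G}_x$. Let $\mathcal{C}_o(p)$ be the set of vertices that can be reached from the origin by following (zero or more) arrows, and for $x\in\mathbb{Z}^d$ let $L_x(p)=\inf\{k\in\mathbb{Z}: x+ke_1\in\mathcal{C}_o(p)\}\in[-\infty,\infty]$,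 with $\inf\varnothing=\infty$. **Theorem.** There is a $p_c\in(0,1)$, depending only on $d$, $(E_1,\dots,E_k)$ and $(r_1,\dots,r_k)$, such that: - if $0\le p<p_c$, then $\mathcal{C}_o(p)=\mathbb{Z}^d$ almost surely; - if $p_c<p<1$, then almost surely $L_x(p)$ is finite for every $x\in\mathbb{Z}^d$ (so $\mathcal{C}_o(p)\ne\mathbb{Z}^d$); - if $p=1$, then almost surely $L_x(p)>-\infty$ for every $x\in\mathbb{Z}^d$ (so $\mathcal{C}_o(p)\ne\mathbb{Z}^d$). -/

import Mathlib

open MeasureTheory ProbabilityTheory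

namespace HalfOrthant

/-- The positive canonical unit vectors of `ℤ^d`. -/
def stepsPos (d : ℕ) : Set (Fin d → ℤ) := {e | ∃ i, e = Pi.single i 1}

/-- The negatives of the canonical unit vectors of `ℤ^d`. -/
def stepsNeg (d : ℕ) : Set (Fin d → ℤ) := {e | ∃ i, e = -Pi.single i 1}

/-- All `2 d` unit steps of `ℤ^d`. -/
def steps (d : ℕ) : Set (Fin d → ℤ) := stepsPos d ∪ stepsNeg d

/-- The first canonical unit vector (coordinates are indexed from `0` by `Fin d`). -/
def e₁ (d : ℕ) [NeZero d] : Fin d → ℤ := Pi.single 0 1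

/-- The probability vectors `(r_1, …, r_k)`. In particular `k ≥ 1` if there is one. -/
def IsProbVector {k : ℕ} (r : Fin k → ℝ) : Prop := (∀ i, 0 ≤ r i) ∧ ∑ i, r i = 1

/-- The half-open interval `[r_1 + ⋯ + r_{i-1}, r_1 + ⋯ + r_i)`. -/
def cell {k : ℕ} (r : Fin k → ℝ) (i : Fin k) : Set ℝ :=
  Set.Ico (∑ j ∈ Finset.Iio i, r j) (∑ j ∈ Finset.Iic i, r j)

/-- The local environment at a site with labels `u`, `u'`: it is `E i` if `u < p` and `u'` lies in
the `i`-th cell of `r`, and `F i` if `p ≤ u` and `u'` lies in the `i`-th cell of `q`.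
(For `u'` outside `[0, 1)`, a null event for a uniform label, it is empty.) -/
def localEnv {d k l : ℕ} (E : Fin k → Set (Fin d → ℤ)) (F : Fin l → Set (Fin d → ℤ))
    (r : Fin k → ℝ) (q : Fin l → ℝ) (p u u' : ℝ) : Set (Fin d → ℤ) :=
  {e | (∃ i, u < p ∧ u' ∈ cell r i ∧ e ∈ E i) ∨ (∃ i, p ≤ u ∧ u' ∈ cell q i ∧ e ∈ F i)}

/-- The forward cluster of `x`: the sites that can be reached from `x` by a (possibly empty)
sequence of arrows, where `G y` is the set of steps that are available at `y`. -/
def forwardCluster {d : ℕ} (G : (Fin d → ℤ) → Set (Fin d → ℤ)) (x : Fin d → ℤ) :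
    Set (Fin d → ℤ) :=
  {y | Relation.ReflTransGen (fun a b => ∃ e ∈ G a, b = a + e) x y}

/-- The environment with `l = 1`, `F_1` the set of all unit steps and `q_1 = 1`, built from the
label configurations `u` and `u'`. -/
def starEnv {d k : ℕ} (E : Fin k → Set (Fin d → ℤ)) (r : Fin k → ℝ) (p : ℝ)
    (u u' : (Fin d → ℤ) → ℝ) (x : Fin d → ℤ) : Set (Fin d → ℤ) :=
  localEnv E (fun _ : Fin 1 => steps d) r (fun _ : Fin 1 => 1) p (u x) (u' x)

/-- The forward cluster of the origin in the environment `starEnv`. -/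
def originCluster {d k : ℕ} (E : Fin k → Set (Fin d → ℤ)) (r : Fin k → ℝ) (p : ℝ)
    (u u' : (Fin d → ℤ) → ℝ) : Set (Fin d → ℤ) :=
  forwardCluster (starEnv E r p u u') 0

/-- `L_x = inf {k ∈ ℤ : x + k e₁ ∈ C}` in the extended reals, with `inf ∅ = ⊤`. -/
noncomputable def leftEnd {d : ℕ} [NeZero d] (C : Set (Fin d → ℤ)) (x : Fin d → ℤ) : EReal :=
  ⨅ k ∈ {k : ℤ | x + k • e₁ d ∈ C}, ((k : ℝ) : EReal)

/-- The assumption on the sets `E_1, …, E_k`: the dimension is at least two, `e₁` lies in all of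
them, and all of them consist of positive unit steps. (That `l = 1` and `F_1` is the set of all
unit steps is built into `starEnv`.) -/
structure StarCondition {d k : ℕ} [NeZero d] (E : Fin k → Set (Fin d → ℤ)) : Prop where
  two_le : 2 ≤ d
  e₁_mem : e₁ d ∈ ⋂ i, E i
  subset_pos : ⋃ i, E i ⊆ stepsPos d

/-- The random variables `X i` are i.i.d. with the uniform law on `(0, 1]`. -/
structure IsIIDUniform {Ω ι : Type*} [MeasurableSpace Ω] (P : Measure Ω) (X : ι → Ω → ℝ) :
    Prop where
  measurable : ∀ i, Measurable (X i)
  indep : iIndepFun X P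
  uniform : ∀ i, pdf.IsUniform (X i) (Set.Ioc 0 1) P volume

end HalfOrthant

/-!
Everything takes place on the product space of label configurations, with law `labelLaw`; the
general case follows because only the joint law of the labels matters. The cluster of the origin
decreases in `p` (`originCluster_antitone`), and `pc` is the supremum of those `p` for which it is
almost surely everything. Four facts give the theorem.

* Whether the cluster is everything has probability zero or one (`labelCluster_zero_one`). The
  origin always leads to `e₁`, so the event contains its translate by `e₁`; both have the same
  probability, and translation is ergodic (`ergodic_comp_injective`).
* For `p < 1`, a cluster that is not everything meets every line parallel to `e₁` in a half-line
  bounded to the left (`eq_univ_or_halfLines`). It always meets each line in a set that is closed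
  to the right. Sites with all arrows occur in both directions along every line, so every line is
  hit, and if one line is covered completely, then so are its neighbours, hence all of them.
  For `p = 1` all arrows are positive and the left ends are trivially bounded below.
* `pc > 0` (`ae_univ_of_small`). If the cluster is not everything, consider the left ends of its
  half-lines along a second direction. The left ends themselves, and the sites of the cluster that
  lie to the left of the left end in an adjacent row, cannot have all arrows. So a contour with
  horizontal displacements `Δ` over `m` rows needs at least `∑ (1 + |Δ i|) / 3` labels below `p`.
  For small `p` the sum of the probabilities over all `Δ` decays exponentially in `m`.
* `pc < 1` (`exists_lt_one_not_ae_univ`). A shortest path of length `n` from the origin to `-e₁`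
  takes `(n + 1) / 2` negative steps, from distinct sites with labels at least `p`. For `p` close
  to `1` the sum over all words of steps is less than one.
-/

namespace HalfOrthant

/-! ### Ergodicity of relabelling an i.i.d. family -/

lemma measurePreserving_comp_injective {ι X : Type*} [MeasurableSpace X] (ν : Measure X)
    [IsProbabilityMeasure ν] {f : ι → ι} (hf : Function.Injective f) :
    MeasurePreserving (fun c : ι → X => c ∘ f) (Measure.infinitePi fun _ => ν)
      (Measure.infinitePi fun _ => ν) :=
  ⟨by unfold Function.comp; fun_prop,
    Measure.map_infinitePi_infinitePi_of_inj (P := fun _ : ι => ν) hf⟩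

lemma iterate_comp_right {ι X : Type*} (f : ι → ι) (n : ℕ) (c : ι → X) :
    (fun c : ι → X => c ∘ f)^[n] c = c ∘ f^[n] := by
  induction n generalizing c with
  | zero => rfl
  | succ m ih => rw [Function.iterate_succ_apply, ih, Function.iterate_succ']; rfl

/-- An injective relabelling whose iterates eventually move every finite set of indices off itself
acts ergodically on an i.i.d. family. An invariant event `S` is approximated by an event that
depends on finitely many coordinates; that event and a far iterate of it are independent, so `S`
is almost independent of itself. -/
theorem ergodic_comp_injective {ι X : Type*} [MeasurableSpace X] (ν : Measure X)
    [IsProbabilityMeasure ν] {f : ι → ι} (hf : Function.Injective f)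
    (hfar : ∀ I : Finset ι, ∃ n : ℕ, ∀ i ∈ I, f^[n] i ∉ I) :
    Ergodic (fun c : ι → X => c ∘ f) (Measure.infinitePi fun _ => ν) := by
  classical
  set μ : Measure (ι → X) := Measure.infinitePi fun _ => ν
  set T : (ι → X) → (ι → X) := fun c => c ∘ f
  have hT : MeasurePreserving T μ μ := measurePreserving_comp_injective ν hf
  refine ⟨hT, ⟨fun S hS hTS => ?_⟩⟩
  have hmul : μ S * μ S = μ S := by
    have key : ∀ ε : ℝ, 0 < ε → |μ.real S - μ.real S * μ.real S| ≤ 4 * ε := by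
      intro ε hε
      obtain ⟨C, hC, hCS⟩ := exists_measure_symmDiff_lt_of_generateFrom_isSetRing (μ := μ)
        (C := measurableCylinders fun _ : ι => X) isSetRing_measurableCylinders
        ⟨{Set.univ}, by simp,
          Set.singleton_subset_iff.2 (univ_mem_measurableCylinders _), by simp⟩
        generateFrom_measurableCylinders.symm hS (ENNReal.ofReal_pos.2 hε)
      obtain ⟨I, B, hB, rfl⟩ := (mem_measurableCylinders C).1 hC
      obtain ⟨n, hn⟩ := hfar I
      have hTn : MeasurePreserving T^[n] μ μ := hT.iterate n
      have hTnS : T^[n] ⁻¹' S = S := by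
        rw [Set.preimage_iterate_eq]
        exact Function.iterate_fixed hTS n
      have hTn_apply : ∀ c, T^[n] c = c ∘ f^[n] := iterate_comp_right f n
      have hCm : MeasurableSet (cylinder I B : Set (ι → X)) := hB.cylinder I
      -- The cylinder and its iterate depend on disjoint sets of coordinates.
      have hind : μ.real (cylinder I B ∩ T^[n] ⁻¹' cylinder I B)
          = μ.real (cylinder I B) * μ.real (cylinder I B) := by
        have hdisj : Disjoint I (I.image f^[n]) := by
          rw [Finset.disjoint_left]
          intro i hi hi'
          obtain ⟨j, hj, rfl⟩ := Finset.mem_image.1 hi'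
          exact hn j hj hi
        have h := (iIndepFun_infinitePi (P := fun _ : ι => ν) (X := fun _ x => x)
          (fun _ => measurable_id)).indepFun_finset I (I.image f^[n]) hdisj
          (fun i => measurable_pi_apply i)
        let g : (I.image f^[n] → X) → (I → X) :=
          fun c i => c ⟨f^[n] i, Finset.mem_image_of_mem _ i.2⟩
        have hg : Measurable g := measurable_pi_lambda _ fun i => measurable_pi_apply _
        have h2 := h.measure_inter_preimage_eq_mul B (g ⁻¹' B) hB (hg hB)
        have e2 : (fun (a : ι → X) (i : I.image f^[n]) => a i) ⁻¹' (g ⁻¹' B)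
            = T^[n] ⁻¹' cylinder I B := by
          ext c
          simp only [Set.mem_preimage, mem_cylinder, hTn_apply]
          rfl
        rw [e2] at h2
        have h3 : μ (T^[n] ⁻¹' cylinder I B) = μ (cylinder I B) :=
          hTn.measure_preimage hCm.nullMeasurableSet
        change μ (cylinder I B ∩ _) = μ (cylinder I B) * _ at h2
        rw [h3] at h2
        simp [Measure.real, h2]
      have hd : μ.real (symmDiff (cylinder I B) S) ≤ ε :=
        ENNReal.toReal_le_of_le_ofReal hε.le hCS.le
      have hd' : μ.real (symmDiff (T^[n] ⁻¹' cylinder I B) S) ≤ ε := by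
        have : symmDiff (T^[n] ⁻¹' cylinder I B) S = T^[n] ⁻¹' symmDiff (cylinder I B) S := by
          conv_lhs => rw [← hTnS]
          exact (Set.preimage_symmDiff _ _).symm
        rw [this, hTn.measureReal_preimage (hCm.symmDiff hS).nullMeasurableSet]
        exact hd
      have h1 : |μ.real (cylinder I B) - μ.real S| ≤ ε :=
        (abs_measureReal_sub_le_measureReal_symmDiff hCm.nullMeasurableSet
          hS.nullMeasurableSet).trans hd
      have h2 : |μ.real (cylinder I B ∩ T^[n] ⁻¹' cylinder I B) - μ.real S| ≤ 2 * ε := by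
        refine (abs_measureReal_sub_le_measureReal_symmDiff
          (hCm.inter (hTn.measurable hCm)).nullMeasurableSet hS.nullMeasurableSet).trans ?_
        have hsub : symmDiff (cylinder I B ∩ T^[n] ⁻¹' cylinder I B) S
            ⊆ symmDiff (cylinder I B) S ∪ symmDiff (T^[n] ⁻¹' cylinder I B) S := by
          intro c
          simp only [Set.mem_symmDiff, Set.mem_inter_iff, Set.mem_union]
          tauto
        have := (measureReal_mono hsub (μ := μ)).trans (measureReal_union_le _ _)
        linarith
      rw [hind] at h2
      have hc0 : 0 ≤ μ.real (cylinder I B) := measureReal_nonneg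
      have hc1 : μ.real (cylinder I B) ≤ 1 := measureReal_le_one
      have hs0 : 0 ≤ μ.real S := measureReal_nonneg
      have hs1 : μ.real S ≤ 1 := measureReal_le_one
      rw [abs_le] at *
      constructor <;> nlinarith
    have h0 : μ.real S - μ.real S * μ.real S = 0 := by
      by_contra hne
      have := key (|μ.real S - μ.real S * μ.real S| / 8) (by positivity)
      have := abs_pos.2 hne
      linarith
    rw [← ENNReal.toReal_eq_toReal_iff' (by finiteness) (by finiteness), ENNReal.toReal_mul]
    change μ.real S * μ.real S = μ.real S
    linarith
  rw [Filter.eventuallyConst_set']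
  rcases eq_or_ne (μ S) 0 with h | h
  · exact .inl (ae_eq_empty.2 h)
  · right
    have : μ S = 1 := (ENNReal.mul_eq_left h (measure_ne_top _ _)).1 hmul
    rw [ae_eq_univ, prob_compl_eq_zero_iff hS]
    exact this

/-! ### Forward clusters in a fixed environment -/

section Cluster

variable {d : ℕ} {G : (Fin d → ℤ) → Set (Fin d → ℤ)}

lemma mem_forwardCluster_self (x : Fin d → ℤ) : x ∈ forwardCluster G x :=
  Relation.ReflTransGen.refl

lemma add_mem_forwardCluster {x y e : Fin d → ℤ} (hy : y ∈ forwardCluster G x) (he : e ∈ G y) :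
    y + e ∈ forwardCluster G x :=
  Relation.ReflTransGen.tail hy ⟨e, he, rfl⟩

lemma forwardCluster_subset {x y : Fin d → ℤ} (hy : y ∈ forwardCluster G x) :
    forwardCluster G y ⊆ forwardCluster G x :=
  fun _ hz => Relation.ReflTransGen.trans hy hz

lemma forwardCluster_mono {H : (Fin d → ℤ) → Set (Fin d → ℤ)} (h : ∀ x, G x ⊆ H x)
    (x : Fin d → ℤ) : forwardCluster G x ⊆ forwardCluster H x :=
  fun _ hy => Relation.ReflTransGen.mono (fun a _ ⟨e, he, hb⟩ => ⟨e, h a he, hb⟩) _ _ hy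

/-- Shifting the environment by `-v` shifts the clusters by `-v`. -/
lemma mem_forwardCluster_shift {v x y : Fin d → ℤ} :
    y ∈ forwardCluster (fun z => G (z + v)) x ↔ y + v ∈ forwardCluster G (x + v) := by
  constructor
  · intro h
    refine Relation.ReflTransGen.lift (· + v) ?_ _ _ h
    rintro a _ ⟨e, he, rfl⟩
    exact ⟨e, he, add_right_comm a e v⟩
  · intro h
    have := Relation.ReflTransGen.lift (p := fun a b => ∃ e ∈ G (a + v), b = a + e) (· - v) ?_ _ _ h
    · simpa [Function.onFun] using! this
    · rintro a _ ⟨e, he, rfl⟩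
      exact ⟨e, by simpa using! he, add_sub_right_comm a e v⟩

/-- A property of sites that is stable under all unit steps and holds somewhere holds
everywhere. -/
lemma forall_of_steps {Q : (Fin d → ℤ) → Prop} {x₀ : Fin d → ℤ} (h₀ : Q x₀)
    (hs : ∀ x, Q x → ∀ e ∈ steps d, Q (x + e)) (x : Fin d → ℤ) : Q x := by
  have hline : ∀ (i : Fin d) (n : ℤ) (y : Fin d → ℤ), Q y → Q (y + n • Pi.single i 1) := by
    intro i n y hy
    induction n with
    | zero => simpa using hy
    | succ n ih =>
      have := hs _ ih (Pi.single i 1) (.inl ⟨i, rfl⟩)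
      rwa [add_assoc, ← add_one_zsmul] at this
    | pred n ih =>
      have := hs _ ih (-Pi.single i 1) (.inr ⟨i, rfl⟩)
      rwa [add_assoc, ← sub_one_zsmul] at this
  have hsum : ∀ s : Finset (Fin d),
      Q (x₀ + ∑ i ∈ s, (x - x₀) i • (Pi.single i 1 : Fin d → ℤ)) := by
    intro s
    induction s using Finset.induction_on with
    | empty => simpa using h₀
    | insert i s hi ih =>
      rw [Finset.sum_insert hi, add_comm (_ • _), ← add_assoc]
      exact hline i _ _ ih
  have hx : x₀ + ∑ i, (x - x₀) i • (Pi.single i 1 : Fin d → ℤ) = x := by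
    ext j
    simp [Finset.sum_apply, Pi.single_apply]
  exact hx ▸ hsum Finset.univ

variable [NeZero d]

lemma ray_mem_forwardCluster (he : ∀ x, e₁ d ∈ G x) {x y : Fin d → ℤ}
    (hy : y ∈ forwardCluster G x) (n : ℕ) : y + (n : ℤ) • e₁ d ∈ forwardCluster G x := by
  induction n with
  | zero => simpa using hy
  | succ n ih =>
    have := add_mem_forwardCluster ih (he _)
    rw [add_assoc, ← add_one_zsmul] at this
    exact_mod_cast this

lemma line_mem_mono (he : ∀ x, e₁ d ∈ G x) {x y : Fin d → ℤ} {k l : ℤ} (hkl : k ≤ l)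
    (hy : y + k • e₁ d ∈ forwardCluster G x) : y + l • e₁ d ∈ forwardCluster G x := by
  obtain ⟨n, rfl⟩ := Int.le.dest hkl
  have := ray_mem_forwardCluster he hy n
  rwa [add_assoc, ← add_zsmul] at this

/-- If sites with all arrows occur in both directions along every line parallel to `e₁`, then
either everything is reached, or the cluster meets every such line exactly in a half-line that is
bounded to the left. The cluster meets all lines because full sites to the right allow a change of
line; a line that is covered completely is left arbitrarily far to the left, so that all its
neighbours are covered as well. -/
theorem eq_univ_or_halfLines (he : ∀ x, e₁ d ∈ G x)
    (hright : ∀ x, ∃ n : ℕ, steps d ⊆ G (x + (n : ℤ) • e₁ d))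
    (hleft : ∀ x, ∃ n : ℕ, steps d ⊆ G (x - (n : ℤ) • e₁ d)) (o : Fin d → ℤ) :
    forwardCluster G o = Set.univ ∨
      ∀ x, ∃ l : ℤ, ∀ k : ℤ, x + k • e₁ d ∈ forwardCluster G o ↔ l ≤ k := by
  have hhit : ∀ x, ∃ k : ℤ, x + k • e₁ d ∈ forwardCluster G o := by
    refine forall_of_steps (x₀ := o) ⟨0, by simpa using mem_forwardCluster_self o⟩ ?_
    rintro x ⟨k, hk⟩ e hes
    obtain ⟨n, hn⟩ := hright (x + k • e₁ d)
    refine ⟨k + n, ?_⟩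
    have := add_mem_forwardCluster (ray_mem_forwardCluster he hk n) (hn hes)
    convert this using 1
    rw [add_zsmul]
    abel
  by_cases hall : ∃ x₀, ∀ k : ℤ, x₀ + k • e₁ d ∈ forwardCluster G o
  · left
    obtain ⟨x₀, hx₀⟩ := hall
    have : ∀ x, ∀ k : ℤ, x + k • e₁ d ∈ forwardCluster G o := by
      refine forall_of_steps hx₀ ?_
      intro x hx e hes k
      obtain ⟨n, hn⟩ := hleft (x + k • e₁ d)
      have h1 : x + k • e₁ d - (n : ℤ) • e₁ d ∈ forwardCluster G o := by
        have := hx (k - n)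
        rwa [sub_zsmul, ← add_assoc, ← sub_eq_add_neg] at this
      have h2 := ray_mem_forwardCluster he (add_mem_forwardCluster h1 (hn hes)) n
      convert h2 using 1
      abel
    exact Set.eq_univ_of_forall fun x => by simpa using this x 0
  · right
    intro x
    push Not at hall
    obtain ⟨k₀, hk₀⟩ := hall x
    obtain ⟨l, hl, hmin⟩ := Int.exists_least_of_bdd
      (P := fun k => x + k • e₁ d ∈ forwardCluster G o)
      ⟨k₀, fun k hk => by
        by_contra hlt
        exact hk₀ (line_mem_mono he (not_le.1 hlt).le hk)⟩ (hhit x)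
    exact ⟨l, fun k => ⟨hmin k, fun h => line_mem_mono he h hl⟩⟩

lemma leftEnd_eq_of_halfLine {C : Set (Fin d → ℤ)} {x : Fin d → ℤ} {l : ℤ}
    (h : ∀ k : ℤ, x + k • e₁ d ∈ C ↔ l ≤ k) : leftEnd C x = ((l : ℝ) : EReal) := by
  refine le_antisymm (iInf₂_le l ((h l).2 le_rfl)) (le_iInf₂ fun k hk => ?_)
  exact_mod_cast (h k).1 hk

lemma leftEnd_ne_bot_of_bddBelow {C : Set (Fin d → ℤ)} {x : Fin d → ℤ} {l : ℤ}
    (h : ∀ k : ℤ, x + k • e₁ d ∈ C → l ≤ k) : leftEnd C x ≠ ⊥ := by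
  have : ((l : ℝ) : EReal) ≤ leftEnd C x := le_iInf₂ fun k hk => by exact_mod_cast h k hk
  exact ne_bot_of_le_ne_bot (EReal.coe_ne_bot _) this

omit [NeZero d] in
/-- With positive arrows only, no coordinate decreases along a path. -/
lemma forwardCluster_nonneg (hG : ∀ x, G x ⊆ stepsPos d) {o x : Fin d → ℤ}
    (hx : x ∈ forwardCluster G o) (i : Fin d) : o i ≤ x i := by
  induction hx with
  | refl => exact le_rfl
  | tail _ h ih =>
    obtain ⟨e, he, rfl⟩ := h
    obtain ⟨j, rfl⟩ := hG _ he
    refine ih.trans ?_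
    by_cases hj : i = j <;> simp [hj]

lemma leftEnd_ne_bot_of_stepsPos (hG : ∀ x, G x ⊆ stepsPos d) (o x : Fin d → ℤ) :
    leftEnd (forwardCluster G o) x ≠ ⊥ := by
  refine leftEnd_ne_bot_of_bddBelow (l := o 0 - x 0) fun k hk => ?_
  have := forwardCluster_nonneg hG hk 0
  simp [e₁] at this
  linarith

end Cluster

/-! ### The environment built from the labels -/

section Env

variable {d k : ℕ} {E : Fin k → Set (Fin d → ℤ)} {r : Fin k → ℝ} {p : ℝ}
  {u u' : (Fin d → ℤ) → ℝ} {x : Fin d → ℤ}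

lemma cell_one (i : Fin 1) : cell (fun _ : Fin 1 => (1 : ℝ)) i = Set.Ico 0 1 := by
  fin_cases i
  simp [cell, show Finset.Iio (0 : Fin 1) = ∅ from rfl,
    show Finset.Iic (0 : Fin 1) = {0} from rfl]

lemma cell_subset (hr : IsProbVector r) (i : Fin k) : cell r i ⊆ Set.Ico 0 1 := by
  refine Set.Ico_subset_Ico (Finset.sum_nonneg fun j _ => hr.1 j) ?_
  rw [← hr.2]
  exact Finset.sum_le_univ_sum_of_nonneg hr.1

lemma exists_mem_cell (hr : IsProbVector r) {t : ℝ} (h0 : 0 ≤ t) (h1 : t < 1) :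
    ∃ i, t ∈ cell r i := by
  classical
  have hex : ∃ n : ℕ, ∃ h : n < k, t < ∑ j ∈ Finset.Iic (⟨n, h⟩ : Fin k), r j := by
    rcases k.eq_zero_or_pos with rfl | hk
    · simp [IsProbVector] at hr
    · refine ⟨k - 1, by omega, ?_⟩
      have : Finset.Iic (⟨k - 1, by omega⟩ : Fin k) = Finset.univ := by
        ext j
        simp only [Finset.mem_Iic, Finset.mem_univ, iff_true, Fin.le_def]
        omega
      rw [this, hr.2]
      exact h1
  obtain ⟨hk, ht⟩ := Nat.find_spec hex
  refine ⟨⟨Nat.find hex, hk⟩, ?_, ht⟩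
  rcases Nat.eq_zero_or_pos (Nat.find hex) with hz | hpos
  · have : Finset.Iio (⟨Nat.find hex, hk⟩ : Fin k) = ∅ := by
      ext j
      simp [Fin.lt_def, hz]
    rw [this]
    simpa using h0
  · have hmin := Nat.find_min hex (m := Nat.find hex - 1) (by omega)
    push Not at hmin
    convert hmin (by omega) using 2
    ext j
    simp only [Finset.mem_Iio, Finset.mem_Iic, Fin.lt_def, Fin.le_def]
    omega

lemma mem_starEnv {e : Fin d → ℤ} : e ∈ starEnv E r p u u' x ↔
    (u x < p ∧ ∃ i, u' x ∈ cell r i ∧ e ∈ E i) ∨ (p ≤ u x ∧ u' x ∈ Set.Ico 0 1 ∧ e ∈ steps d) := by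
  simp [starEnv, localEnv, cell_one]

lemma steps_subset_starEnv (hu' : u' x ∈ Set.Ico 0 1) (hp : p ≤ u x) :
    steps d ⊆ starEnv E r p u u' x :=
  fun _ he => mem_starEnv.2 (.inr ⟨hp, hu', he⟩)

variable [NeZero d]

lemma e₁_mem_starEnv (hE : StarCondition E) (hr : IsProbVector r) (hu' : u' x ∈ Set.Ico 0 1) :
    e₁ d ∈ starEnv E r p u u' x := by
  rw [mem_starEnv]
  rcases lt_or_ge (u x) p with h | h
  · obtain ⟨i, hi⟩ := exists_mem_cell hr hu'.1 hu'.2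
    exact .inl ⟨h, i, hi, Set.mem_iInter.1 hE.e₁_mem i⟩
  · exact .inr ⟨h, hu', .inl ⟨0, rfl⟩⟩

lemma starEnv_subset_stepsPos (hE : StarCondition E) (hu : u x < p) :
    starEnv E r p u u' x ⊆ stepsPos d := by
  intro e he
  rcases mem_starEnv.1 he with ⟨_, i, _, hi⟩ | ⟨h, _⟩
  · exact hE.subset_pos (Set.mem_iUnion.2 ⟨i, hi⟩)
  · exact absurd hu (not_lt.2 h)

lemma starEnv_antitone (hE : StarCondition E) (hr : IsProbVector r) {p' : ℝ} (hpp : p ≤ p') :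
    starEnv E r p' u u' x ⊆ starEnv E r p u u' x := by
  intro e he
  rcases mem_starEnv.1 he with ⟨h, i, hi, hei⟩ | ⟨h, h', hes⟩
  · rcases lt_or_ge (u x) p with hp | hp
    · exact mem_starEnv.2 (.inl ⟨hp, i, hi, hei⟩)
    · exact mem_starEnv.2 (.inr ⟨hp, cell_subset hr i hi,
        .inl (hE.subset_pos (Set.mem_iUnion.2 ⟨i, hei⟩))⟩)
  · exact mem_starEnv.2 (.inr ⟨hpp.trans h, h', hes⟩)

lemma originCluster_antitone (hE : StarCondition E) (hr : IsProbVector r) {p' : ℝ}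
    (hpp : p ≤ p') : originCluster E r p' u u' ⊆ originCluster E r p u u' :=
  forwardCluster_mono (fun _ => starEnv_antitone hE hr hpp) 0

end Env

/-! ### The law of the labels -/

/-- The uniform distribution on `(0, 1]`. -/
noncomputable def unitLaw : Measure ℝ := ProbabilityTheory.cond volume (Set.Ioc 0 1)

instance : IsProbabilityMeasure unitLaw :=
  ProbabilityTheory.cond_isProbabilityMeasure_of_finite (by simp) (by simp)

/-- The joint law of both families of labels, on the product space. The left summand indexes
the labels `U`, the right one the labels `U'`. -/
noncomputable def labelLaw (d : ℕ) : Measure ((Fin d → ℤ) ⊕ (Fin d → ℤ) → ℝ) :=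
  Measure.infinitePi fun _ => unitLaw

instance (d : ℕ) : IsProbabilityMeasure (labelLaw d) :=
  inferInstanceAs (IsProbabilityMeasure (Measure.infinitePi _))

lemma unitLaw_apply {B : Set ℝ} : unitLaw B = volume (Set.Ioc 0 1 ∩ B) := by
  simp [unitLaw, ProbabilityTheory.cond_apply measurableSet_Ioc]

lemma unitLaw_Iio {p : ℝ} (h1 : p ≤ 1) : unitLaw (Set.Iio p) = ENNReal.ofReal p := by
  have : Set.Ioc 0 1 ∩ Set.Iio p = Set.Ioo 0 p := by
    ext t
    simp only [Set.mem_inter_iff, Set.mem_Ioc, Set.mem_Iio, Set.mem_Ioo]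
    constructor <;> intro h
    · exact ⟨h.1.1, h.2⟩
    · exact ⟨⟨h.1, by linarith⟩, h.2⟩
  simp [unitLaw_apply, this]

lemma unitLaw_Ici {p : ℝ} (h1 : p ≤ 1) : unitLaw (Set.Ici p) = 1 - ENNReal.ofReal p := by
  rw [← unitLaw_Iio h1, ← prob_compl_eq_one_sub measurableSet_Iio, Set.compl_Iio]

lemma labelLaw_map {d : ℕ} {Ω : Type*} [MeasurableSpace Ω] {P : Measure Ω}
    [IsProbabilityMeasure P] {X : (Fin d → ℤ) ⊕ (Fin d → ℤ) → Ω → ℝ} (hX : IsIIDUniform P X) :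
    P.map (fun ω i => X i ω) = labelLaw d := by
  rw [hX.indep.map_fun_eq_infinitePi_map hX.measurable]
  unfold labelLaw
  congr 1
  ext1 i
  exact hX.uniform i

lemma labelLaw_forall_mem {d : ℕ} (D : Finset (Fin d → ℤ)) {B : Set ℝ} (hB : MeasurableSet B) :
    labelLaw d {c | ∀ x ∈ D, c (.inl x) ∈ B} = unitLaw B ^ D.card := by
  have : {c : (Fin d → ℤ) ⊕ (Fin d → ℤ) → ℝ | ∀ x ∈ D, c (.inl x) ∈ B}
      = Set.pi (D.map Function.Embedding.inl : Finset ((Fin d → ℤ) ⊕ (Fin d → ℤ)))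
        fun _ => B := by
    ext c
    simp [Set.mem_pi]
  rw [this, labelLaw, Measure.infinitePi_pi _ fun _ _ => hB]
  simp

lemma ae_label {d : ℕ} (i : (Fin d → ℤ) ⊕ (Fin d → ℤ)) {Q : ℝ → Prop}
    (hQ : ∀ᵐ t ∂unitLaw, Q t) : ∀ᵐ c ∂labelLaw d, Q (c i) :=
  (measurePreserving_eval_infinitePi (fun _ => unitLaw) i).quasiMeasurePreserving.ae hQ

lemma ae_mem_Ico_unitLaw : ∀ᵐ t ∂unitLaw, t ∈ Set.Ico (0 : ℝ) 1 := by
  rw [ae_iff]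
  have h : Set.Ioc (0 : ℝ) 1 ∩ {t | t ∉ Set.Ico (0 : ℝ) 1} ⊆ {1} := by
    rintro t ⟨⟨h0, h1⟩, h2⟩
    simp only [Set.mem_Ico, not_and, not_lt, Set.mem_ofPred_eq] at h2
    exact le_antisymm h1 (h2 h0.le)
  rw [unitLaw_apply]
  exact measure_mono_null h (by simp)

lemma ae_labels_mem_Ico (d : ℕ) :
    ∀ᵐ c ∂labelLaw d, ∀ i, c i ∈ Set.Ico (0 : ℝ) 1 :=
  ae_all_iff.2 fun i => ae_label i ae_mem_Ico_unitLaw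

/-- Below `p = 1`, every half-line of sites contains a site with label at least `p`. -/
lemma ae_exists_le_label {d : ℕ} {p : ℝ} (h1 : p < 1) {v : Fin d → ℤ} (hv : v ≠ 0) :
    ∀ᵐ c ∂labelLaw d, ∀ x : Fin d → ℤ, ∃ n : ℕ, p ≤ c (.inl (x + (n : ℤ) • v)) := by
  refine ae_all_iff.2 fun x => ?_
  rw [ae_iff]
  have hinj : Function.Injective fun n : ℕ => x + (n : ℤ) • v := by
    intro m n h
    have := smul_left_injective ℤ hv (add_left_cancel h)
    exact_mod_cast this
  have hle : ∀ N : ℕ, labelLaw d {c | ¬ ∃ n : ℕ, p ≤ c (.inl (x + (n : ℤ) • v))}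
      ≤ ENNReal.ofReal p ^ N := by
    intro N
    rw [← unitLaw_Iio h1.le]
    have hcard : ((Finset.range N).map ⟨_, hinj⟩).card = N := by simp
    conv_rhs => rw [← hcard]
    rw [← labelLaw_forall_mem _ measurableSet_Iio]
    refine measure_mono fun c hc => ?_
    simp only [not_exists, not_le, Set.mem_ofPred_eq] at hc
    simp only [Finset.mem_map, Function.Embedding.coeFn_mk, Set.mem_Iio, Set.mem_ofPred_eq]
    rintro _ ⟨n, _, rfl⟩
    exact hc n
  have hlim := ENNReal.tendsto_pow_atTop_nhds_zero_of_lt_one (ENNReal.ofReal_lt_one.2 h1)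
  exact le_antisymm (ge_of_tendsto' hlim hle) zero_le

/-! ### The zero-one law for reaching everything -/

section ZeroOne

variable {d k : ℕ} {E : Fin k → Set (Fin d → ℤ)} {r : Fin k → ℝ} {p : ℝ}

/-- The forward cluster of the origin as a function of the joint configuration of labels. -/
def labelCluster (E : Fin k → Set (Fin d → ℤ)) (r : Fin k → ℝ) (p : ℝ)
    (c : (Fin d → ℤ) ⊕ (Fin d → ℤ) → ℝ) : Set (Fin d → ℤ) :=
  originCluster E r p (fun x => c (.inl x)) (fun x => c (.inr x))

lemma measurableSet_mem_starEnv (x e : Fin d → ℤ) : MeasurableSet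
    {c : (Fin d → ℤ) ⊕ (Fin d → ℤ) → ℝ |
      e ∈ starEnv E r p (fun x => c (.inl x)) (fun x => c (.inr x)) x} := by
  have hu : Measurable fun c : (Fin d → ℤ) ⊕ (Fin d → ℤ) → ℝ => c (.inl x) := by fun_prop
  have hu' : Measurable fun c : (Fin d → ℤ) ⊕ (Fin d → ℤ) → ℝ => c (.inr x) := by fun_prop
  simp only [mem_starEnv, Set.ofPred_or, Set.ofPred_and, Set.ofPred_exists]
  exact ((hu measurableSet_Iio).inter (.iUnion fun i => (hu' measurableSet_Ico).inter
    (.const _))).union ((hu measurableSet_Ici).inter ((hu' measurableSet_Ico).inter (.const _)))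

/-- The sites that are reached from the origin in exactly `n` steps. -/
def reachedIn (G : (Fin d → ℤ) → Set (Fin d → ℤ)) : ℕ → Set (Fin d → ℤ)
  | 0 => {0}
  | n + 1 => {y | ∃ z ∈ reachedIn G n, y - z ∈ G z}

lemma mem_reachedIn_succ {G : (Fin d → ℤ) → Set (Fin d → ℤ)} {n : ℕ} {y : Fin d → ℤ} :
    y ∈ reachedIn G (n + 1) ↔ ∃ z, z ∈ reachedIn G n ∧ y - z ∈ G z := Iff.rfl

lemma mem_forwardCluster_iff_reachedIn {G : (Fin d → ℤ) → Set (Fin d → ℤ)} {y : Fin d → ℤ} :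
    y ∈ forwardCluster G 0 ↔ ∃ n, y ∈ reachedIn G n := by
  constructor
  · intro h
    induction h with
    | refl => exact ⟨0, rfl⟩
    | tail _ h ih =>
      obtain ⟨n, hn⟩ := ih
      obtain ⟨e, he, rfl⟩ := h
      exact ⟨n + 1, _, hn, by simpa using he⟩
  · rintro ⟨n, hn⟩
    induction n generalizing y with
    | zero =>
      obtain rfl : y = 0 := hn
      exact mem_forwardCluster_self 0
    | succ n ih =>
      obtain ⟨z, hz, hy⟩ := hn
      simpa using add_mem_forwardCluster (ih hz) hy

lemma measurableSet_labelCluster_eq_univ :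
    MeasurableSet {c | labelCluster E r p c = Set.univ} := by
  have h : ∀ (n : ℕ) (y : Fin d → ℤ), MeasurableSet
      {c : (Fin d → ℤ) ⊕ (Fin d → ℤ) → ℝ |
        y ∈ reachedIn (starEnv E r p (fun x => c (.inl x)) (fun x => c (.inr x))) n} := by
    intro n
    induction n with
    | zero => exact fun y => .const _
    | succ n ih =>
      intro y
      simp only [mem_reachedIn_succ, Set.ofPred_exists, Set.ofPred_and]
      exact MeasurableSet.iUnion fun z => (ih z).inter (measurableSet_mem_starEnv z (y - z))
  simp only [labelCluster, originCluster, Set.eq_univ_iff_forall,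
    mem_forwardCluster_iff_reachedIn, Set.ofPred_forall, Set.ofPred_exists]
  exact MeasurableSet.iInter fun y => MeasurableSet.iUnion fun n => h n y

variable [NeZero d]

lemma e₁_ne_zero : e₁ d ≠ 0 := by
  intro h
  have := congrFun h 0
  simp [e₁] at this

/-- Whether the cluster of the origin is everything has probability zero or one. Since the origin
always leads to `e₁`, the event contains its translate by `e₁`, and this translation is ergodic. -/
theorem labelCluster_zero_one (hE : StarCondition E) (hr : IsProbVector r) (p : ℝ) :
    (∀ᵐ c ∂labelLaw d, labelCluster E r p c = Set.univ) ∨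
      ∀ᵐ c ∂labelLaw d, labelCluster E r p c ≠ Set.univ := by
  set f : (Fin d → ℤ) ⊕ (Fin d → ℤ) → (Fin d → ℤ) ⊕ (Fin d → ℤ) :=
    Sum.map (· + e₁ d) (· + e₁ d)
  have hf : Function.Injective f :=
    Function.Injective.sumMap (add_left_injective _) (add_left_injective _)
  have hfar : ∀ I : Finset ((Fin d → ℤ) ⊕ (Fin d → ℤ)), ∃ n : ℕ, ∀ i ∈ I, f^[n] i ∉ I := by
    intro I
    -- The first coordinate of the site grows by one in each iteration.
    let g : (Fin d → ℤ) ⊕ (Fin d → ℤ) → ℤ := Sum.elim (fun x => x 0) (fun x => x 0)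
    have hg : ∀ n i, g (f^[n] i) = g i + n := by
      intro n i
      induction n with
      | zero => simp
      | succ n ih =>
        have : ∀ j, g (f j) = g j + 1 := by rintro (j | j) <;> simp [f, g, e₁]
        rw [Function.iterate_succ_apply', this, ih]
        push_cast
        ring
    refine ⟨∑ i ∈ I, 2 * (g i).natAbs + 1, fun i hi hi' => ?_⟩
    have h1 := Finset.single_le_sum (f := fun i => 2 * (g i).natAbs) (fun _ _ => Nat.zero_le _) hi
    have h2 := Finset.single_le_sum (f := fun i => 2 * (g i).natAbs) (fun _ _ => Nat.zero_le _) hi'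
    have h3 := hg (∑ i ∈ I, 2 * (g i).natAbs + 1) i
    simp only at h1 h2
    omega
  have herg := ergodic_comp_injective unitLaw hf hfar
  have hle : (fun c => c ∘ f) ⁻¹' {c | labelCluster E r p c = Set.univ}
      ≤ᵐ[labelLaw d] {c | labelCluster E r p c = Set.univ} := by
    filter_upwards [ae_labels_mem_Ico d] with c hc h
    refine Set.eq_univ_of_forall fun y => ?_
    have hy : y - e₁ d ∈ labelCluster E r p (c ∘ f) := by
      rw [show labelCluster E r p (c ∘ f) = Set.univ from h]
      trivial
    have := (mem_forwardCluster_shift (v := e₁ d)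
      (G := starEnv E r p (fun x => c (.inl x)) (fun x => c (.inr x)))).1 hy
    rw [sub_add_cancel] at this
    exact forwardCluster_subset (add_mem_forwardCluster (mem_forwardCluster_self 0)
      (e₁_mem_starEnv hE hr (hc _))) this
  rcases herg.ae_empty_or_univ_of_preimage_ae_le
    measurableSet_labelCluster_eq_univ.nullMeasurableSet hle with h | h
  · right
    filter_upwards [h] with c hc hc'
    exact (show c ∈ (∅ : Set _) from hc.mp hc')
  · left
    filter_upwards [h] with c hc
    exact hc.mpr trivial

/-- Below `p = 1`, almost surely either everything is reached, or the cluster of the origin meets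
each line parallel to `e₁` in a half-line bounded to the left. -/
theorem ae_labelCluster_eq_univ_or_halfLines (hE : StarCondition E) (hr : IsProbVector r)
    (h1 : p < 1) : ∀ᵐ c ∂labelLaw d, labelCluster E r p c = Set.univ ∨
      ∀ x, ∃ l : ℤ, ∀ k : ℤ, x + k • e₁ d ∈ labelCluster E r p c ↔ l ≤ k := by
  filter_upwards [ae_labels_mem_Ico d, ae_exists_le_label h1 (e₁_ne_zero (d := d)),
    ae_exists_le_label h1 (neg_ne_zero.2 (e₁_ne_zero (d := d)))] with c hc hright hleft
  refine eq_univ_or_halfLines (fun x => e₁_mem_starEnv hE hr (hc _)) (fun x => ?_) (fun x => ?_) 0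
  · obtain ⟨n, hn⟩ := hright x
    exact ⟨n, steps_subset_starEnv (hc _) hn⟩
  · obtain ⟨n, hn⟩ := hleft x
    refine ⟨n, steps_subset_starEnv (hc _) ?_⟩
    simpa [sub_eq_add_neg] using hn

end ZeroOne

/-! ### Encoding paths by their increments -/

/-- The partial sums of a finite sequence, constant from the end of the sequence on. -/
def prefixSum {M : Type*} [AddCommMonoid M] {n : ℕ} (f : Fin n → M) (i : ℕ) : M :=
  ∑ j ∈ Finset.range i, if h : j < n then f ⟨j, h⟩ else 0

section PrefixSum

variable {M : Type*} {n : ℕ}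

@[simp]
lemma prefixSum_zero [AddCommMonoid M] (f : Fin n → M) : prefixSum f 0 = 0 := by
  simp [prefixSum]

lemma prefixSum_succ [AddCommMonoid M] (f : Fin n → M) {i : ℕ} (h : i < n) :
    prefixSum f (i + 1) = prefixSum f i + f ⟨i, h⟩ := by
  simp [prefixSum, Finset.sum_range_succ, h]

lemma prefixSum_succ_of_le [AddCommMonoid M] (f : Fin n → M) {i : ℕ} (h : n ≤ i) :
    prefixSum f (i + 1) = prefixSum f i := by
  simp [prefixSum, Finset.sum_range_succ, not_lt.2 h]

lemma prefixSum_last [AddCommMonoid M] (f : Fin n → M) : prefixSum f n = ∑ i, f i := by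
  rw [prefixSum, Finset.sum_range]
  simp

lemma prefixSum_sub [AddCommGroup M] (x : ℕ → M) {i : ℕ} (h : i ≤ n) :
    prefixSum (fun j : Fin n => x (j + 1) - x j) i = x i - x 0 := by
  induction i with
  | zero => simp
  | succ i ih =>
    rw [prefixSum_succ _ h, ih (Nat.le_of_succ_le h)]
    simp

end PrefixSum

/-! ### Few full sites: not everything is reached -/

section Upper

variable {d k : ℕ} {E : Fin k → Set (Fin d → ℤ)} {r : Fin k → ℝ} {p : ℝ}

/-- A site at distance `n` from the origin is the end of a path whose `i`-th site is at distance
`i`. In particular the sites of this path are distinct. -/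
lemma exists_geodesic {G : (Fin d → ℤ) → Set (Fin d → ℤ)} {n : ℕ} {y : Fin d → ℤ}
    (hy : y ∈ reachedIn G n) (hmin : ∀ m < n, y ∉ reachedIn G m) :
    ∃ x : ℕ → Fin d → ℤ, x 0 = 0 ∧ x n = y ∧ (∀ i < n, x (i + 1) - x i ∈ G (x i)) ∧
      ∀ i ≤ n, x i ∈ reachedIn G i ∧ ∀ m < i, x i ∉ reachedIn G m := by
  induction n generalizing y with
  | zero => exact ⟨fun _ => 0, rfl, Eq.symm hy, by simp, by simp [reachedIn]⟩
  | succ n ih =>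
    obtain ⟨z, hz, hyz⟩ := hy
    obtain ⟨x, h0, hn, hstep, hdist⟩ := ih hz fun m hm h =>
      hmin (m + 1) (by omega) ⟨z, h, hyz⟩
    refine ⟨fun i => if i ≤ n then x i else y, by simpa using h0, by simp, ?_, ?_⟩
    · intro i hi
      rcases Nat.lt_succ_iff_lt_or_eq.1 hi with h | rfl
      · simpa [h.le, Nat.succ_le_of_lt h] using hstep i h
      · simpa [hn] using hyz
    · intro i hi
      rcases Nat.le_succ_iff.1 hi with h | rfl
      · simpa [h] using hdist i h
      · simpa using! And.intro (show y ∈ reachedIn G (n + 1) from ⟨z, hz, hyz⟩)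
          fun m hm => hmin m (Nat.lt_succ_of_le hm)

/-- The `2 d` unit steps, encoded by a direction and by whether the step is positive. -/
def stepVec (s : Fin d × Bool) : Fin d → ℤ :=
  if s.2 then Pi.single s.1 1 else -Pi.single s.1 1

lemma exists_stepVec {e : Fin d → ℤ} (he : e ∈ steps d) : ∃ s, stepVec s = e := by
  rcases he with ⟨i, rfl⟩ | ⟨i, rfl⟩
  · exact ⟨(i, true), rfl⟩
  · exact ⟨(i, false), rfl⟩

lemma sum_stepVec (s : Fin d × Bool) : ∑ i, stepVec s i = if s.2 then 1 else -1 := by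
  rcases s with ⟨i, _ | _⟩ <;> simp [stepVec]

lemma stepVec_notMem_stepsPos {s : Fin d × Bool} (hs : s.2 = false) :
    stepVec s ∉ stepsPos d := by
  rintro ⟨i, hi⟩
  have := sum_stepVec s
  rw [hi] at this
  simp [hs] at this

lemma starEnv_subset_steps [NeZero d] (hE : StarCondition E) {u u' : (Fin d → ℤ) → ℝ}
    {x : Fin d → ℤ} : starEnv E r p u u' x ⊆ steps d := by
  intro e he
  rcases mem_starEnv.1 he with ⟨_, i, _, hi⟩ | ⟨_, _, h⟩
  · exact .inl (hE.subset_pos (Set.mem_iUnion.2 ⟨i, hi⟩))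
  · exact h

/-- The event that the word `s` describes a path from the origin through distinct sites that ends
on the hyperplane of coordinate sum `-1`, and all of whose negative steps start at sites with
label at least `p`. -/
def wordEvent (p : ℝ) {n : ℕ} (s : Fin n → Fin d × Bool) :
    Set ((Fin d → ℤ) ⊕ (Fin d → ℤ) → ℝ) :=
  {c | (Function.Injective fun i : Fin n => prefixSum (stepVec ∘ s) i) ∧
    ∑ j, prefixSum (stepVec ∘ s) n j = -1 ∧
    ∀ i, (s i).2 = false → p ≤ c (.inl (prefixSum (stepVec ∘ s) i))}

lemma exists_mem_wordEvent [NeZero d] (hE : StarCondition E)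
    {c : (Fin d → ℤ) ⊕ (Fin d → ℤ) → ℝ} (hc : -e₁ d ∈ labelCluster E r p c) :
    ∃ n, ∃ s : Fin n → Fin d × Bool, c ∈ wordEvent p s := by
  classical
  set G := starEnv E r p (fun x => c (.inl x)) (fun x => c (.inr x))
  have hex := mem_forwardCluster_iff_reachedIn.1 hc
  obtain ⟨x, h0, hn, hstep, hdist⟩ :=
    exists_geodesic (Nat.find_spec hex) fun m hm => Nat.find_min hex hm
  generalize Nat.find hex = n at *
  have hs : ∀ i : Fin n, ∃ s, stepVec s = x (i + 1) - x i := fun i =>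
    exists_stepVec (starEnv_subset_steps hE (hstep i i.2))
  choose s hs using hs
  have hcomp : stepVec ∘ s = fun i : Fin n => x (i + 1) - x i := funext hs
  have hpos : ∀ i ≤ n, prefixSum (stepVec ∘ s) i = x i := by
    intro i hi
    rw [hcomp, prefixSum_sub x hi, h0, sub_zero]
  refine ⟨n, s, ?_, ?_, ?_⟩
  · intro i j hij
    simp only [hpos i i.2.le, hpos j j.2.le] at hij
    by_contra hne
    rcases lt_or_gt_of_ne (fun h => hne (Fin.ext h) : (i : ℕ) ≠ j) with h | h
    · exact (hdist j j.2.le).2 i h (hij ▸ (hdist i i.2.le).1)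
    · exact (hdist i i.2.le).2 j h (hij ▸ (hdist j j.2.le).1)
  · rw [hpos n le_rfl, hn]
    simp [e₁]
  · intro i hi
    rw [hpos i i.2.le]
    by_contra hlt
    refine stepVec_notMem_stepsPos hi ?_
    rw [hs i]
    exact starEnv_subset_stepsPos hE (not_le.1 hlt) (hstep i i.2)

/-- A word of length `n` as in `wordEvent` has `(n + 1) / 2` negative steps, and these start at
distinct sites. -/
lemma labelLaw_wordEvent_le {t : ℝ} (ht : 0 ≤ t) (ht1 : t ≤ 1) {n : ℕ} (s : Fin n → Fin d × Bool) :
    labelLaw d (wordEvent (1 - t ^ 2) s) ≤ ENNReal.ofReal t ^ (n + 1) := by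
  classical
  by_cases hs : (Function.Injective fun i : Fin n => prefixSum (stepVec ∘ s) i) ∧
    ∑ j, prefixSum (stepVec ∘ s) n j = -1
  swap
  · have : wordEvent (1 - t ^ 2) s = ∅ :=
      Set.eq_empty_of_forall_notMem fun c hc => hs ⟨hc.1, hc.2.1⟩
    simp [this]
  obtain ⟨hinj, hsum⟩ := hs
  set N : Finset (Fin n) := Finset.univ.filter fun i => (s i).2 = false
  have hN : 2 * N.card = n + 1 := by
    have h1 : ∑ i, (if (s i).2 then (1 : ℤ) else -1) = -1 := by
      conv_rhs => rw [← hsum, prefixSum_last]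
      simp only [Finset.sum_apply]
      rw [Finset.sum_comm]
      exact Finset.sum_congr rfl fun i _ => (sum_stepVec (s i)).symm
    have h2 : ∀ i, (if (s i).2 then (1 : ℤ) else -1) = 1 - 2 * if (s i).2 = false then 1 else 0 := by
      intro i
      cases (s i).2 <;> simp
    simp only [h2, Finset.sum_sub_distrib, ← Finset.mul_sum, Finset.sum_boole] at h1
    simp only [Finset.sum_const, Finset.card_univ, Fintype.card_fin, nsmul_eq_mul, mul_one] at h1
    have h3 : (2 * N.card : ℤ) = n + 1 := by
      simp only [N]
      linarith
    exact_mod_cast h3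
  calc labelLaw d (wordEvent (1 - t ^ 2) s)
      ≤ labelLaw d {c | ∀ x ∈ N.image fun i : Fin n => prefixSum (stepVec ∘ s) i,
          c (.inl x) ∈ Set.Ici (1 - t ^ 2)} := by
        refine measure_mono fun c hc x hx => ?_
        obtain ⟨i, hi, rfl⟩ := Finset.mem_image.1 hx
        exact hc.2.2 i (Finset.mem_filter.1 hi).2
    _ = (ENNReal.ofReal t ^ 2) ^ N.card := by
        rw [labelLaw_forall_mem _ measurableSet_Ici, Finset.card_image_of_injective _ hinj]
        congr 1
        rw [unitLaw_Ici (by nlinarith), ← ENNReal.ofReal_one,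
          ← ENNReal.ofReal_sub _ (by nlinarith), sub_sub_cancel, ENNReal.ofReal_pow ht]
    _ = ENNReal.ofReal t ^ (n + 1) := by rw [← pow_mul, hN]

/-- Near `p = 1` the site `-e₁` is missed with positive probability: there are at most `(2 d) ^ n`
words of length `n`, and each of them describes a path with probability at most
`(1 - p) ^ ((n + 1) / 2)`. -/
theorem exists_lt_one_not_ae_univ [NeZero d] (hE : StarCondition E) (r : Fin k → ℝ) :
    ∃ p : ℝ, 0 ≤ p ∧ p < 1 ∧ ¬ ∀ᵐ c ∂labelLaw d, labelCluster E r p c = Set.univ := by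
  have hd : (2 : ℝ) ≤ d := by exact_mod_cast hE.two_le
  set t : ℝ := 1 / (4 * d)
  have ht : 0 < t := by positivity
  have ht1 : t < 1 / 2 := by
    rw [div_lt_div_iff₀ (by positivity) (by norm_num)]
    linarith
  refine ⟨1 - t ^ 2, by nlinarith, by nlinarith [sq_pos_of_pos ht], fun h => ?_⟩
  have hfull : 1 ≤ labelLaw d (⋃ n, ⋃ s : Fin n → Fin d × Bool, wordEvent (1 - t ^ 2) s) := by
    rw [← measure_univ (μ := labelLaw d)]
    refine measure_mono_ae ?_
    filter_upwards [h] with c hc _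
    have := exists_mem_wordEvent hE (hc ▸ Set.mem_univ (-e₁ d))
    exact Set.mem_iUnion₂.2 this
  refine absurd hfull (not_le.2 ?_)
  have hratio : ((2 * d : ℕ) : ENNReal) * ENNReal.ofReal t = 2⁻¹ := by
    rw [← ENNReal.ofReal_natCast, ← ENNReal.ofReal_mul (by positivity),
      ← ENNReal.ofReal_ofNat 2, ← ENNReal.ofReal_inv_of_pos (by norm_num)]
    congr 1
    simp only [t]
    push_cast
    field_simp
    norm_num
  calc labelLaw d (⋃ n, ⋃ s : Fin n → Fin d × Bool, wordEvent (1 - t ^ 2) s)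
      ≤ ∑' n : ℕ, ∑' s : Fin n → Fin d × Bool, ENNReal.ofReal t ^ (n + 1) :=
        (measure_iUnion_le _).trans (ENNReal.tsum_le_tsum fun n =>
          (measure_iUnion_le _).trans (ENNReal.tsum_le_tsum fun s =>
            labelLaw_wordEvent_le ht.le (by linarith) s))
    _ = ∑' n : ℕ, 2⁻¹ ^ n * ENNReal.ofReal t := by
        refine tsum_congr fun n => ?_
        rw [tsum_fintype, Finset.sum_const, Finset.card_univ, nsmul_eq_mul, ← hratio, mul_pow,
          pow_succ, mul_assoc]
        simp [mul_comm]
    _ = ENNReal.ofReal (2 * t) := by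
        rw [ENNReal.tsum_mul_right, ENNReal.tsum_geometric, ENNReal.one_sub_inv_two, inv_inv,
          ENNReal.ofReal_mul (by norm_num), ENNReal.ofReal_ofNat]
    _ < 1 := ENNReal.ofReal_lt_one.2 (by linarith)

end Upper

/-! ### Few sites with positive steps only: everything is reached -/

lemma tsum_pi_prod {α : Type*} (f : α → ENNReal) (m : ℕ) :
    ∑' x : Fin m → α, ∏ i, f (x i) = (∑' a, f a) ^ m := by
  induction m with
  | zero => simp [tsum_fintype]
  | succ m ih =>
    rw [← (Fin.consEquiv fun _ => α).tsum_eq, ENNReal.tsum_prod', pow_succ', ← ih,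
      ← ENNReal.tsum_mul_right]
    refine tsum_congr fun a => ?_
    rw [← ENNReal.tsum_mul_left]
    refine tsum_congr fun x => ?_
    simp [Fin.consEquiv, Fin.prod_univ_succ]

/-- The total weight of the possible displacements of a contour between two rows. -/
lemma tsum_quarter_pow_lt_one : ∑' n : ℤ, (4⁻¹ : ENNReal) ^ (1 + n.natAbs) < 1 := by
  have hg : ∑' n : ℕ, (4⁻¹ : ENNReal) ^ n = ENNReal.ofReal (4 / 3) := by
    rw [ENNReal.tsum_geometric]
    rw [show (4⁻¹ : ENNReal) = ENNReal.ofReal (1 / 4) by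
      rw [one_div, ENNReal.ofReal_inv_of_pos (by norm_num), ENNReal.ofReal_ofNat],
      ← ENNReal.ofReal_one, ← ENNReal.ofReal_sub _ (by norm_num),
      ← ENNReal.ofReal_inv_of_pos (by norm_num)]
    norm_num
  rw [tsum_of_nat_of_neg_add_one ENNReal.summable ENNReal.summable]
  have h1 : ∀ n : ℕ, (4⁻¹ : ENNReal) ^ (1 + (n : ℤ).natAbs) = 4⁻¹ * 4⁻¹ ^ n := by
    intro n
    rw [Int.natAbs_natCast, pow_add, pow_one]
  have h2 : ∀ n : ℕ, (4⁻¹ : ENNReal) ^ (1 + (-((n : ℤ) + 1)).natAbs) = 4⁻¹ ^ 2 * 4⁻¹ ^ n := by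
    intro n
    rw [show (-((n : ℤ) + 1)).natAbs = n + 1 by omega, ← pow_add]
    congr 1
    ring
  simp only [h1, h2, ENNReal.tsum_mul_left, hg]
  rw [show (4⁻¹ : ENNReal) = ENNReal.ofReal (1 / 4) by
      rw [one_div, ENNReal.ofReal_inv_of_pos (by norm_num), ENNReal.ofReal_ofNat],
    ← ENNReal.ofReal_pow (by norm_num), ← ENNReal.ofReal_mul (by norm_num),
    ← ENNReal.ofReal_mul (by norm_num), ← ENNReal.ofReal_add (by norm_num) (by norm_num),
    ENNReal.ofReal_lt_one]
  norm_num

section Contour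

/-- The sites of the `i`-th row that are blocked if the rows of a cluster start at `l`: the left
end of the row, and all sites to its right that lie to the left of the start of an adjacent
row. -/
noncomputable def blockedRow (l : ℕ → ℤ) (i : ℕ) : Finset ℤ :=
  Finset.Icc (l i) (max (l i) (max (l (i + 1)) (l (i - 1)) - 1))

lemma one_le_card_blockedRow (l : ℕ → ℤ) (i : ℕ) : 1 ≤ (blockedRow l i).card := by
  simp only [blockedRow, Int.card_Icc]
  omega

lemma sub_le_card_blockedRow (l : ℕ → ℤ) (i : ℕ) :
    l (i + 1) - l i ≤ (blockedRow l i).card := by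
  simp only [blockedRow, Int.card_Icc]
  omega

lemma sub_le_card_blockedRow_succ (l : ℕ → ℤ) (i : ℕ) :
    l i - l (i + 1) ≤ (blockedRow l (i + 1)).card := by
  simp only [blockedRow, Int.card_Icc, Nat.add_sub_cancel]
  omega

/-- Each unit of height and of horizontal displacement of a contour is paid for by blocked sites,
and no blocked site is used more than three times. -/
lemma sum_natAbs_le (l : ℕ → ℤ) (m : ℕ) :
    ∑ i ∈ Finset.range m, (1 + (l (i + 1) - l i).natAbs)
      ≤ 3 * ∑ i ∈ Finset.range (m + 1), (blockedRow l i).card := by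
  have h : ∀ i ∈ Finset.range m, 1 + (l (i + 1) - l i).natAbs
      ≤ 2 * (blockedRow l i).card + (blockedRow l (i + 1)).card := by
    intro i _
    have h1 := one_le_card_blockedRow l i
    have h2 := sub_le_card_blockedRow l i
    have h3 := sub_le_card_blockedRow_succ l i
    omega
  have h1 := Finset.sum_range_succ (fun i => (blockedRow l i).card) m
  have h2 := Finset.sum_range_succ' (fun i => (blockedRow l i).card) m
  have h3 := Finset.sum_le_sum h
  rw [Finset.sum_add_distrib (f := fun i => 2 * (blockedRow l i).card), ← Finset.mul_sum] at h3
  omega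

variable {d k : ℕ} [NeZero d] {E : Fin k → Set (Fin d → ℤ)} {r : Fin k → ℝ} {p : ℝ}

/-- The site in column `j` of row `i` of the plane spanned by `e₁` and a further direction `v`. -/
def planeSite (v : Fin d → ℤ) (i : ℕ) (j : ℤ) : Fin d → ℤ := (i : ℤ) • v + j • e₁ d

/-- The rows of a cluster start at a contour with initial height `a` and increments `Δ`, and all
sites blocked by this contour have labels below `p`. -/
def contourEvent (p : ℝ) (v : Fin d → ℤ) (a : ℤ) {m : ℕ} (Δ : Fin m → ℤ) :
    Set ((Fin d → ℤ) ⊕ (Fin d → ℤ) → ℝ) :=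
  {c | ∀ i ≤ m, ∀ j ∈ blockedRow (fun i => a + prefixSum Δ i) i, c (.inl (planeSite v i j)) < p}

lemma planeSite_injective {i₂ : Fin d} (hi₂ : i₂ ≠ 0) :
    Function.Injective fun s : (_ : ℕ) × ℤ => planeSite (Pi.single i₂ 1) s.1 s.2 := by
  rintro ⟨i, j⟩ ⟨i', j'⟩ h
  have h1 := congrFun h i₂
  have h2 := congrFun h 0
  simp [planeSite, e₁, hi₂, hi₂.symm] at h1 h2
  simp [h1, h2]

lemma labelLaw_contourEvent_le {i₂ : Fin d} (hi₂ : i₂ ≠ 0) (a : ℤ) {m : ℕ} (Δ : Fin m → ℤ) :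
    labelLaw d (contourEvent (4⁻¹ ^ 3) (Pi.single i₂ 1) a Δ)
      ≤ ∏ i, (4⁻¹ : ENNReal) ^ (1 + (Δ i).natAbs) := by
  set l : ℕ → ℤ := fun i => a + prefixSum Δ i
  set D := ((Finset.range (m + 1)).sigma (blockedRow l)).map ⟨_, planeSite_injective hi₂⟩
  have hD : D.card = ∑ i ∈ Finset.range (m + 1), (blockedRow l i).card := by
    simp [D, Finset.card_sigma]
  calc labelLaw d (contourEvent (4⁻¹ ^ 3) (Pi.single i₂ 1) a Δ)
      ≤ labelLaw d {c | ∀ x ∈ D, c (.inl x) ∈ Set.Iio (4⁻¹ ^ 3)} := by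
        refine measure_mono fun c hc x hx => ?_
        obtain ⟨⟨i, j⟩, hij, rfl⟩ := Finset.mem_map.1 hx
        obtain ⟨hi, hj⟩ := Finset.mem_sigma.1 hij
        exact hc i (Nat.lt_succ_iff.1 (Finset.mem_range.1 hi)) j hj
    _ = (4⁻¹ ^ 3) ^ D.card := by
        rw [labelLaw_forall_mem _ measurableSet_Iio, unitLaw_Iio (by norm_num),
          ENNReal.ofReal_pow (by norm_num), ENNReal.ofReal_inv_of_pos (by norm_num),
          ENNReal.ofReal_ofNat]
    _ ≤ 4⁻¹ ^ ∑ i ∈ Finset.range m, (1 + (l (i + 1) - l i).natAbs) := by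
        rw [← pow_mul, hD]
        exact pow_le_pow_of_le_one zero_le (ENNReal.inv_le_one.2 (by norm_num))
          (sum_natAbs_le l m)
    _ = ∏ i, (4⁻¹ : ENNReal) ^ (1 + (Δ i).natAbs) := by
        rw [← Finset.prod_pow_eq_pow_sum, Finset.prod_range]
        refine Finset.prod_congr rfl fun i _ => ?_
        simp [l, prefixSum_succ Δ i.2]

/-- If the cluster meets the lines parallel to `e₁` in proper half-lines, then their left ends
along a second direction form a contour all of whose blocked sites have labels below `p`: a site
of the cluster with all arrows that is blocked would lead to a site to the left of the contour. -/
lemma exists_mem_contourEvent {i₂ : Fin d} {c : (Fin d → ℤ) ⊕ (Fin d → ℤ) → ℝ}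
    (hc : ∀ i, c i ∈ Set.Ico (0 : ℝ) 1)
    (h : ∀ x, ∃ l : ℤ, ∀ k : ℤ, x + k • e₁ d ∈ labelCluster E r p c ↔ l ≤ k) :
    ∃ a : ℤ, ∀ m : ℕ, ∃ Δ : Fin m → ℤ, c ∈ contourEvent p (Pi.single i₂ 1) a Δ := by
  set v : Fin d → ℤ := Pi.single i₂ 1
  choose L hL using h
  set l : ℕ → ℤ := fun i => L ((i : ℤ) • v)
  have hl : ∀ i j, planeSite v i j ∈ labelCluster E r p c ↔ l i ≤ j := fun i j => hL _ j
  refine ⟨l 0, fun m => ⟨fun i => l (i + 1) - l i, fun i hi j hj => ?_⟩⟩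
  have hpre : ∀ i ≤ m, l 0 + prefixSum (fun i : Fin m => l (i + 1) - l i) i = l i := by
    intro i hi
    rw [prefixSum_sub l hi]
    ring
  by_contra hlt
  have hstep : ∀ e ∈ steps d, planeSite v i j ∈ labelCluster E r p c →
      planeSite v i j + e ∈ labelCluster E r p c := fun e he hmem =>
    add_mem_forwardCluster hmem (steps_subset_starEnv (hc _) (not_lt.1 hlt) he)
  simp only [blockedRow, Finset.mem_Icc, hpre i hi, hpre (i - 1) (by omega)] at hj
  have hmem : planeSite v i j ∈ labelCluster E r p c := (hl i j).2 hj.1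
  have hcases : j = l i ∨ (i < m ∧ j < l (i + 1)) ∨ (1 ≤ i ∧ j < l (i - 1)) := by
    rcases hi.lt_or_eq with him | rfl
    · rw [hpre (i + 1) him] at hj
      rcases Nat.eq_zero_or_pos i with rfl | hpos
      · simp only [Nat.zero_sub] at hj
        omega
      · omega
    · rw [prefixSum_succ_of_le _ le_rfl, hpre i le_rfl] at hj
      rcases Nat.eq_zero_or_pos i with rfl | hpos
      · simp only [Nat.zero_sub] at hj
        omega
      · omega
  rcases hcases with rfl | ⟨_, hlt'⟩ | ⟨h1, hlt'⟩
  · have := hstep (-e₁ d) (.inr ⟨0, rfl⟩) hmem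
    rw [show planeSite v i (l i) + -e₁ d = planeSite v i (l i - 1) by
      simp only [planeSite, sub_smul, one_smul]; abel, hl] at this
    omega
  · have := hstep v (.inl ⟨i₂, rfl⟩) hmem
    rw [show planeSite v i j + v = planeSite v (i + 1) j by
      simp only [planeSite, Nat.cast_add, Nat.cast_one, add_smul, one_smul]; abel, hl] at this
    omega
  · have := hstep (-v) (.inr ⟨i₂, rfl⟩) hmem
    rw [show planeSite v i j + -v = planeSite v (i - 1) j by
      simp only [planeSite, Nat.cast_sub h1, Nat.cast_one, sub_smul, one_smul]; abel, hl] at this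
    omega

/-- For small `p` everything is reached: otherwise there are contours of all lengths with a common
start, but the expected number of blocked contours of length `m` decays exponentially. -/
theorem ae_univ_of_small (hE : StarCondition E) (hr : IsProbVector r) :
    ∀ᵐ c ∂labelLaw d, labelCluster E r (4⁻¹ ^ 3) c = Set.univ := by
  have hd := hE.two_le
  set i₂ : Fin d := ⟨1, hd⟩
  have hi₂ : i₂ ≠ 0 := by
    rw [Ne, Fin.ext_iff]
    simp [i₂]
  have hnull : ∀ a : ℤ, ∀ᵐ c ∂labelLaw d, ¬ ∀ m : ℕ, ∃ Δ : Fin m → ℤ,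
      c ∈ contourEvent (4⁻¹ ^ 3) (Pi.single i₂ 1) a Δ := by
    intro a
    rw [ae_iff]
    simp only [not_not]
    have hle : ∀ m : ℕ, labelLaw d {c | ∀ m : ℕ, ∃ Δ : Fin m → ℤ,
        c ∈ contourEvent (4⁻¹ ^ 3) (Pi.single i₂ 1) a Δ}
        ≤ (∑' n : ℤ, (4⁻¹ : ENNReal) ^ (1 + n.natAbs)) ^ m := by
      intro m
      calc _ ≤ labelLaw d (⋃ Δ : Fin m → ℤ, contourEvent (4⁻¹ ^ 3) (Pi.single i₂ 1) a Δ) :=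
            measure_mono fun c (hc : ∀ m : ℕ, ∃ Δ : Fin m → ℤ,
              c ∈ contourEvent (4⁻¹ ^ 3) (Pi.single i₂ 1) a Δ) => Set.mem_iUnion.2 (hc m)
        _ ≤ ∑' Δ : Fin m → ℤ, ∏ i, (4⁻¹ : ENNReal) ^ (1 + (Δ i).natAbs) :=
            (measure_iUnion_le _).trans
              (ENNReal.tsum_le_tsum fun Δ => labelLaw_contourEvent_le hi₂ a Δ)
        _ = _ := tsum_pi_prod (fun n : ℤ => (4⁻¹ : ENNReal) ^ (1 + n.natAbs)) m
    have hlim := ENNReal.tendsto_pow_atTop_nhds_zero_of_lt_one tsum_quarter_pow_lt_one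
    exact le_antisymm (ge_of_tendsto' hlim hle) zero_le
  filter_upwards [ae_labels_mem_Ico d, ae_all_iff.2 hnull,
    ae_labelCluster_eq_univ_or_halfLines hE hr (p := 4⁻¹ ^ 3) (by norm_num)] with c hc hn hdich
  refine hdich.resolve_right fun hlines => ?_
  obtain ⟨a, ha⟩ := exists_mem_contourEvent (i₂ := i₂) hc hlines
  exact hn a ha

end Contour

end HalfOrthant

open HalfOrthant in
theorem theorem2 (d : ℕ) [NeZero d] (k : ℕ) (E : Fin k → Set (Fin d → ℤ)) (r : Fin k → ℝ)
    (hE : HalfOrthant.StarCondition E) (hr : HalfOrthant.IsProbVector r) :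
    ∃ pc : ℝ, 0 < pc ∧ pc < 1 ∧
      ∀ (Ω : Type*) [MeasurableSpace Ω] (P : Measure Ω) [IsProbabilityMeasure P]
        (U U' : (Fin d → ℤ) → Ω → ℝ),
        HalfOrthant.IsIIDUniform P (Sum.elim U U') →
        ∀ p : ℝ, 0 ≤ p → p ≤ 1 →
          (p < pc → ∀ᵐ ω ∂P,
            HalfOrthant.originCluster E r p (fun x => U x ω) (fun x => U' x ω) = Set.univ) ∧
          (pc < p → ∀ᵐ ω ∂P,
            (∀ x : Fin d → ℤ, HalfOrthant.leftEnd
              (HalfOrthant.originCluster E r p (fun y => U y ω) (fun y => U' y ω)) x ≠ ⊥) ∧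
            (p < 1 → ∀ x : Fin d → ℤ, HalfOrthant.leftEnd
              (HalfOrthant.originCluster E r p (fun y => U y ω) (fun y => U' y ω)) x ≠ ⊤) ∧
            HalfOrthant.originCluster E r p (fun x => U x ω) (fun x => U' x ω) ≠ Set.univ) := by
  set A : Set ℝ := {p | ∀ᵐ c ∂labelLaw d, labelCluster E r p c = Set.univ}
  have hanti : ∀ p p', p ≤ p' → p' ∈ A → p ∈ A := by
    intro p p' hpp (hp' : ∀ᵐ c ∂labelLaw d, _)
    refine hp'.mono fun c hc => Set.eq_univ_of_univ_subset ?_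
    rw [← hc]
    exact originCluster_antitone hE hr hpp
  obtain ⟨p₁, hp₁0, hp₁1, hp₁⟩ := exists_lt_one_not_ae_univ hE r
  have hsmall : (4⁻¹ ^ 3 : ℝ) ∈ A := ae_univ_of_small hE hr
  have hub : ∀ p ∈ A, p ≤ p₁ := fun p hp => not_lt.1 fun h => hp₁ (hanti _ _ h.le hp)
  refine ⟨sSup A, ?_, (csSup_le ⟨_, hsmall⟩ hub).trans_lt hp₁1, ?_⟩
  · exact lt_of_lt_of_le (by norm_num) (le_csSup ⟨p₁, hub⟩ hsmall)
  intro Ω _ P _ U U' hU p hp0 hp1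
  -- It suffices to argue on the product space, which carries the joint law of the labels.
  have htransfer : ∀ Q : ((Fin d → ℤ) ⊕ (Fin d → ℤ) → ℝ) → Prop, (∀ᵐ c ∂labelLaw d, Q c) →
      ∀ᵐ ω ∂P, Q fun i => Sum.elim U U' i ω := by
    intro Q hQ
    rw [← labelLaw_map hU] at hQ
    exact ae_of_ae_map (measurable_pi_lambda _ hU.measurable).aemeasurable hQ
  constructor
  · intro hlt
    obtain ⟨p', hp', hpp'⟩ := exists_lt_of_lt_csSup ⟨_, hsmall⟩ hlt
    exact htransfer (fun c => labelCluster E r p c = Set.univ) (hanti _ _ hpp'.le hp')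
  · intro hlt
    have hnA : p ∉ A := fun h => absurd (le_csSup ⟨p₁, hub⟩ h) (not_le.2 hlt)
    have hne : ∀ᵐ c ∂labelLaw d, labelCluster E r p c ≠ Set.univ :=
      (labelCluster_zero_one hE hr p).resolve_left hnA
    refine htransfer (fun c => (∀ x, leftEnd (labelCluster E r p c) x ≠ ⊥) ∧
      (p < 1 → ∀ x, leftEnd (labelCluster E r p c) x ≠ ⊤) ∧
      labelCluster E r p c ≠ Set.univ) ?_
    rcases hp1.lt_or_eq with h1 | rfl
    · filter_upwards [hne, ae_labelCluster_eq_univ_or_halfLines hE hr h1] with c hc hdich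
      have hlines := hdich.resolve_left hc
      refine ⟨fun x => ?_, fun _ x => ?_, hc⟩ <;> obtain ⟨l, hl⟩ := hlines x <;>
        rw [leftEnd_eq_of_halfLine hl]
      · exact EReal.coe_ne_bot _
      · exact EReal.coe_ne_top _
    · -- For `p = 1` all labels lie below `p`, so that all arrows are positive.
      filter_upwards [hne, ae_labels_mem_Ico d] with c hc hlab
      exact ⟨leftEnd_ne_bot_of_stepsPos (fun x => starEnv_subset_stepsPos hE (hlab _).2) 0,
        fun h => absurd h (lt_irrefl _), hc⟩
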